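/- Setting. All costs are one. For $f:\{0,1\}^n\to\{\pm1\}$ let $\mathrm{Inf}_i(f)=\Pr_x[f(x)\ne f(x^{\oplus i})]$ (with $x$ uniform, and $x^{\oplus i}$ denoting $x$ with coordinate $i$ flipped) and $\mathrm{Inf}(f)=\sum_i \mathrm{Inf}_i(f)$. A strategy adaptively queries coordinates of an input $x$, possibly using random coins, and then outputs a value in $\{\pm1\}$. Its error for $f$ is the probability that the output differs from $f(x)$, and its expected cost is the expected number of queries, both over uniform $x$ and the coins. Let $\mathrm{opt}(f,\varepsilon)$ be the minimum expected cost of a strategy with error at most $\varepsilon$ for $f$. A strategy *recursively queries the most influential variable* of $f$ if every coordinate that it queries is a most influential variable (ties broken arbitrarily) of the restriction of $f$ by the answers obtained so far; the rule by which it stops, and its outputs, are arbitrary. For a budget $B\ge 0$ the strategy $\mathcal S^\star$ is the following one. It keeps a counter $k$, initially $0$. While $k<B$ and not all coordinates have been queried, it takes a not yet queried most influential variable $i$ of the current restriction of $f$ (ties broken arbitrarily). If $k+1<B$, it queries $i$, restricts $f$ accordingly, and increases $k$ by one. If $k+1\ge B$, then with probability $B-k$ it queries $i$, restricts $f$ accordingly,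 and stops; with the remaining probability it stops at once. When it stops, it outputs the sign of $\mathbb E[f]$ for the current restriction of $f$ (an arbitrary value in $\{\pm 1\}$ if this mean is $0$). Theorem. There is an absolute constant $q\in\mathbb N$ such that for every $\varepsilon\in(0,\frac14)$ there is a constant $C=C(\varepsilon)>0$ with the following property. For every real $K$ there are an $n$ and a function $f:\{0,1\}^n\to\{\pm1\}$ with $\mathrm{Inf}(f)\ge K$ and $\mathrm{opt}(f,\varepsilon)\ge K$ such that 1. for every budget $B\ge0$, if $\mathcal S^\star$ with budget $B$ has error at most $\varepsilon$ for $f$, then its expected cost is at least $$\mathrm{opt}(f,\varepsilon)\cdot \frac{C\cdot\mathrm{Inf}(f)}{\big(\log(2+\mathrm{Inf}(f))\big)^{q}};$$ 2. the same lower bound holds for the expected cost of every strategy that has error at most $\varepsilon$ for $f$ and recursively queries the most influential variable of $f$, whatever its stopping rule. -/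

import Mathlib

/-- A boolean function `f : {0,1}ⁿ → {±1}`; the group `ℤˣ` of units of `ℤ` is `{1, -1}`. -/
abbrev BoolFun (n : ℕ) : Type := (Fin n → Bool) → ℤˣ

namespace BoolFun

variable {n : ℕ}

/-- The restriction `f_{xᵢ = b}`, as a function on the whole cube that ignores coordinate `i`
(so that uniform averages over the cube are uniform averages over the subcube `xᵢ = b`). -/
def restrict (f : BoolFun n) (i : Fin n) (b : Bool) : BoolFun n :=
  fun x => f (Function.update x i b)

/-- `Inf_i(f) = Pr_x[f(x) ≠ f(x^{⊕ i})]` for uniform `x`. -/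
noncomputable def influence (f : BoolFun n) (i : Fin n) : ℝ :=
  ((Finset.univ.filter fun x : Fin n → Bool =>
      f x ≠ f (Function.update x i (!(x i)))).card : ℝ) / 2 ^ n

/-- The total influence `Inf(f) = ∑ i, Inf_i(f)`. -/
noncomputable def totalInfluence (f : BoolFun n) : ℝ :=
  ∑ i, f.influence i

/-- `E[f(x)]` for uniform `x`. -/
noncomputable def mean (f : BoolFun n) : ℝ :=
  (∑ x : Fin n → Bool, ((f x : ℤ) : ℝ)) / 2 ^ n

/-- `b = sign(E[f])`; if `E[f] = 0` either sign is allowed. -/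
def IsSignMean (f : BoolFun n) (b : ℤˣ) : Prop :=
  (0 < f.mean → b = 1) ∧ (f.mean < 0 → b = -1)

/-- `i` is a most influential variable of `f` (one of them, if there are ties). -/
def IsMostInfluential (f : BoolFun n) (i : Fin n) : Prop :=
  ∀ j, f.influence j ≤ f.influence i

/-- `i` has the largest cost-weighted influence `Inf_i(f) / c_i` (ties are allowed). -/
def IsMaxCostWeighted (f : BoolFun n) (c : Fin n → ℕ) (i : Fin n) : Prop :=
  ∀ j, f.influence j / (c j : ℝ) ≤ f.influence i / (c i : ℝ)

end BoolFun

/-- A (possibly randomized) query strategy for inputs in `{0,1}ⁿ`: it stops with an output, or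
queries coordinate `i` and continues with `t₀` or `t₁` according to whether the answer is
`0` (`false`) or `1` (`true`), or flips a coin, continuing with the first strategy with
probability `p` and with the second one with probability `1 - p`. -/
inductive Strategy (n : ℕ) : Type
  | output (b : ℤˣ) : Strategy n
  | query (i : Fin n) (t₀ t₁ : Strategy n) : Strategy n
  | flip (p : unitInterval) (t u : Strategy n) : Strategy n

namespace Strategy

variable {n : ℕ}

/-- The cost `cost_c(S, x)` of `S` on the input `x`, in expectation over the coins of `S`. -/
noncomputable def cost (c : Fin n → ℕ) : Strategy n → (Fin n → Bool) → ℝ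
  | output _, _ => 0
  | query i t₀ t₁, x => (c i : ℝ) + (bif x i then cost c t₁ x else cost c t₀ x)
  | flip p t u, x => (p : ℝ) * cost c t x + (1 - (p : ℝ)) * cost c u x

/-- The probability, over the coins of `S`, that `S(x) ≠ f(x)`. -/
noncomputable def errorAt (f : BoolFun n) : Strategy n → (Fin n → Bool) → ℝ
  | output b, x => if b = f x then 0 else 1
  | query i t₀ t₁, x => bif x i then errorAt f t₁ x else errorAt f t₀ x
  | flip p t u, x => (p : ℝ) * errorAt f t x + (1 - (p : ℝ)) * errorAt f u x

/-- `Δ_c(S) = E_x[cost_c(S, x)]` for uniform `x`. -/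
noncomputable def expectedCost (c : Fin n → ℕ) (S : Strategy n) : ℝ :=
  (∑ x : Fin n → Bool, S.cost c x) / 2 ^ n

/-- `error_f(S) = Pr_x[S(x) ≠ f(x)]` for uniform `x`. -/
noncomputable def error (f : BoolFun n) (S : Strategy n) : ℝ :=
  (∑ x : Fin n → Bool, S.errorAt f x) / 2 ^ n

/-- `S` recursively queries a most influential variable of `f`: whenever it makes a query, the
queried coordinate is a most influential variable of the current restriction of `f`. Nothing is
required about when it stops, what it outputs, or how it uses coins. -/
def QueriesMostInfluential : BoolFun n → Strategy n → Prop
  | _, output _ => True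
  | f, query i t₀ t₁ => f.IsMostInfluential i ∧
      QueriesMostInfluential (f.restrict i false) t₀ ∧
      QueriesMostInfluential (f.restrict i true) t₁
  | f, flip _ t u => QueriesMostInfluential f t ∧ QueriesMostInfluential f u

/-- `IsSStarFrom c B f Q k S`: `S` is a continuation of the greedy strategy with budget `B`, from
the state in which `f` is the current restriction, the coordinates in `Q` have been queried, and
the counter is `k`. In this state the strategy stops once the counter has reached the budget (or
nothing is left to query). Otherwise it takes an unqueried coordinate `i` of largest cost-weighted
influence. If the counter would reach the budget by this query, then the query is made with
probability `(B - k) / c i` only, and the strategy outputs the sign of the mean; else the query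
is made, and the strategy goes on. Any rule for breaking ties is allowed. -/
inductive IsSStarFrom (c : Fin n → ℕ) (B : ℝ) :
    BoolFun n → Finset (Fin n) → ℕ → Strategy n → Prop
  | halt (f : BoolFun n) (Q : Finset (Fin n)) (k : ℕ) (b : ℤˣ)
      (hend : B ≤ (k : ℝ) ∨ Q = Finset.univ) (hb : f.IsSignMean b) :
      IsSStarFrom c B f Q k (output b)
  | last (f : BoolFun n) (Q : Finset (Fin n)) (k : ℕ) (i : Fin n) (p : unitInterval)
      (b b₀ b₁ : ℤˣ) (hk : (k : ℝ) < B) (hiQ : i ∉ Q) (hi : f.IsMaxCostWeighted c i)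
      (hlast : B ≤ (k : ℝ) + (c i : ℝ)) (hp : (p : ℝ) = (B - (k : ℝ)) / (c i : ℝ))
      (hb : f.IsSignMean b) (hb₀ : (f.restrict i false).IsSignMean b₀)
      (hb₁ : (f.restrict i true).IsSignMean b₁) :
      IsSStarFrom c B f Q k (flip p (query i (output b₀) (output b₁)) (output b))
  | step (f : BoolFun n) (Q : Finset (Fin n)) (k : ℕ) (i : Fin n) (t₀ t₁ : Strategy n)
      (hiQ : i ∉ Q) (hi : f.IsMaxCostWeighted c i) (hk : (k : ℝ) + (c i : ℝ) < B)
      (h₀ : IsSStarFrom c B (f.restrict i false) (insert i Q) (k + c i) t₀)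
      (h₁ : IsSStarFrom c B (f.restrict i true) (insert i Q) (k + c i) t₁) :
      IsSStarFrom c B f Q k (query i t₀ t₁)

/-- `S` is the strategy `S*` for `f` with cost vector `c` and budget `B`. -/
def IsSStar (f : BoolFun n) (c : Fin n → ℕ) (B : ℝ) (S : Strategy n) : Prop :=
  IsSStarFrom c B f ∅ 0 S

end Strategy

/-- `opt(f, c, ε)`: the minimum expected cost of an `ε`-error strategy for `f`. -/
noncomputable def optCost {n : ℕ} (f : BoolFun n) (c : Fin n → ℕ) (ε : ℝ) : ℝ :=
  sInf {r : ℝ | ∃ S : Strategy n, S.error f ≤ ε ∧ r = S.expectedCost c}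

/-- The unit-cost setting `c = 1ⁿ`. -/
def unitCost (n : ℕ) : Fin n → ℕ := fun _ => 1

/-! The hard function splits the coordinates into disjoint blocks, of three kinds: `2 ^ w` blocks in
`A` and `b * 2 ^ w` blocks in `B`, all of width `w`, and `4 ^ w` remaining blocks, of the slightly
smaller width `v = w - (2 * b + 3)`. Its value is `1` if some block of `A` is all true, else `-1` if
some block of `B` is, else the parity of the number of all-true remaining blocks (`hybrid` applied
to `blockSign`).

No block of `A ∪ B` is all true with probability about `e ^ (-(b + 1))`, which is at most `ε` for
large `b`. So reading `A ∪ B`, at a cost of order `w * 2 ^ w`, suffices (`optCost_hybrid_le`). The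
parity matters only with this small constant probability, but its blocks are narrower by enough that
each of their coordinates beats every coordinate of `A ∪ B` in influence. This persists under
restriction as long as one parity block is untouched. Hence a greedy strategy touches all `4 ^ w`
parity blocks before it asks about `A ∪ B`, and until then each output is wrong with probability at
least `3/10 > ε`, since `A` and `B` alone force both values that often (`le_error_hybrid`,
`le_error_add_cost_of_queriesMostInfluential`). The greedy cost is thus of order `4 ^ w`. Since the
total influence is between `2 ^ w` and a constant times `w * 2 ^ w`, the ratio of the costs is of
order `Inf / log² Inf`.

Both lower bounds on cost come from one potential argument, `le_error_add_cost`: an invariant that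
survives `k` queries and forces error at least `v` makes error plus `β` times cost at least `β * k`,
when `β * k ≤ v`. For arbitrary strategies the invariant is that influences are small: a query at
most doubles them and moves the mean by at most one influence (`le_error_add_cost_of_influence_le`).
This makes `optCost` unbounded. -/

/-- The average of `φ` over the uniform distribution on the cube. -/
noncomputable def cubeAvg {n : ℕ} (φ : (Fin n → Bool) → ℝ) : ℝ :=
  (∑ x, φ x) / 2 ^ n

/-- The probability of `E` under the uniform distribution on the cube. -/
noncomputable def cubeProb {n : ℕ} (E : Set (Fin n → Bool)) : ℝ :=
  (E.ncard : ℝ) / 2 ^ n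

/-! ### Averages and probabilities over the cube. -/

section Averages

variable {n : ℕ}

theorem cubeAvg_mono {φ ψ : (Fin n → Bool) → ℝ} (h : ∀ x, φ x ≤ ψ x) :
    cubeAvg φ ≤ cubeAvg ψ := by
  unfold cubeAvg
  gcongr with x
  exact h x

theorem cubeAvg_add (φ ψ : (Fin n → Bool) → ℝ) :
    cubeAvg (fun x => φ x + ψ x) = cubeAvg φ + cubeAvg ψ := by
  simp only [cubeAvg, Finset.sum_add_distrib, add_div]

theorem cubeAvg_mul (a : ℝ) (φ : (Fin n → Bool) → ℝ) :
    cubeAvg (fun x => a * φ x) = a * cubeAvg φ := by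
  simp only [cubeAvg, ← Finset.mul_sum, mul_div_assoc]

theorem cubeAvg_const (a : ℝ) : cubeAvg (fun _ : Fin n → Bool => a) = a := by
  simp [cubeAvg]

theorem cubeAvg_nonneg {φ : (Fin n → Bool) → ℝ} (h : ∀ x, 0 ≤ φ x) : 0 ≤ cubeAvg φ := by
  unfold cubeAvg
  have := Finset.sum_nonneg fun x (_ : x ∈ Finset.univ) => h x
  positivity

theorem sum_flip (φ : (Fin n → Bool) → ℝ) (i : Fin n) :
    ∑ x, φ (Function.update x i (!(x i))) = ∑ x, φ x := by
  have hinv : Function.Involutive fun x : Fin n → Bool => Function.update x i (!(x i)) := by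
    intro x
    simp
  exact Equiv.sum_comp hinv.toPerm φ

/-- Averaging over the two halves of the cube. -/
theorem cubeAvg_update (φ : (Fin n → Bool) → ℝ) (i : Fin n) :
    cubeAvg (fun x => φ (Function.update x i false)) +
      cubeAvg (fun x => φ (Function.update x i true)) = 2 * cubeAvg φ := by
  have h : ∀ x : Fin n → Bool, φ (Function.update x i false) + φ (Function.update x i true) =
      φ x + φ (Function.update x i (!(x i))) := by
    intro x
    cases hx : x i with
    | false =>
      have : Function.update x i false = x := by rw [← hx]; exact Function.update_eq_self i x
      rw [this, Bool.not_false]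
    | true =>
      have : Function.update x i true = x := by rw [← hx]; exact Function.update_eq_self i x
      rw [this, Bool.not_true, add_comm]
  rw [← cubeAvg_add, funext h, cubeAvg_add, two_mul]
  simp only [cubeAvg, sum_flip]

theorem cubeProb_eq_cubeAvg (E : Set (Fin n → Bool)) [DecidablePred (· ∈ E)] :
    cubeProb E = cubeAvg fun x => if x ∈ E then 1 else 0 := by
  rw [cubeProb, cubeAvg, Set.ncard_eq_toFinset_card' E, Finset.sum_boole]
  congr 3
  ext
  simp

theorem cubeProb_mono {E E' : Set (Fin n → Bool)} (h : E ⊆ E') : cubeProb E ≤ cubeProb E' := by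
  unfold cubeProb
  gcongr
  exact Set.toFinite _

theorem cubeProb_diff {E E' : Set (Fin n → Bool)} (h : E ⊆ E') :
    cubeProb (E' \ E) = cubeProb E' - cubeProb E := by
  rw [cubeProb, cubeProb, cubeProb, Set.cast_ncard_sdiff h (Set.toFinite _), sub_div]

theorem cubeProb_compl (E : Set (Fin n → Bool)) : cubeProb Eᶜ = 1 - cubeProb E := by
  rw [Set.compl_eq_univ_sdiff, cubeProb_diff (Set.subset_univ _)]
  congr 1
  simp [cubeProb, Set.ncard_univ]

/-! ### The effect of one query on the mean and the influences. -/

namespace BoolFun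

theorem influence_eq_cubeProb (f : BoolFun n) (i : Fin n) :
    f.influence i = cubeProb {x | f x ≠ f (Function.update x i (!(x i)))} := by
  rw [influence, cubeProb, Set.ncard_eq_toFinset_card']
  congr 3
  ext
  simp

theorem influence_nonneg (f : BoolFun n) (i : Fin n) : 0 ≤ f.influence i := by
  unfold influence
  positivity

/-- The restricted value at `x` is one of the two values on the edge through `x` in direction `i`.
It differs from their average only if the edge is sensitive, and then by `1`. -/
theorem abs_mean_restrict_le (f : BoolFun n) (i : Fin n) (b : Bool) :
    |(f.restrict i b).mean| ≤ |f.mean| + f.influence i := by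
  have key : ∀ x, |((f.restrict i b x : ℤ) : ℝ) -
      ((((f x : ℤ) : ℝ) + ((f (Function.update x i (!(x i))) : ℤ) : ℝ)) / 2)| ≤
      if x ∈ {x | f x ≠ f (Function.update x i (!(x i)))} then 1 else 0 := by
    intro x
    have hb : f.restrict i b x = f x ∨ f.restrict i b x = f (Function.update x i (!(x i))) := by
      unfold restrict
      by_cases hx : x i = b
      · left; rw [← hx, Function.update_eq_self]
      · right
        have : b = !(x i) := by cases b <;> cases h : x i <;> simp_all
        rw [this]
    rcases Int.units_eq_one_or (f x) with h1 | h1 <;>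
      rcases Int.units_eq_one_or (f (Function.update x i (!(x i)))) with h2 | h2 <;>
      rcases hb with hb | hb <;> simp [hb, h1, h2]
  have hm : (f.restrict i b).mean - f.mean = cubeAvg fun x => ((f.restrict i b x : ℤ) : ℝ) -
      ((((f x : ℤ) : ℝ) + ((f (Function.update x i (!(x i))) : ℤ) : ℝ)) / 2) := by
    have := sum_flip (fun x => ((f x : ℤ) : ℝ)) i
    simp only [mean, cubeAvg, Finset.sum_sub_distrib, ← Finset.sum_div, Finset.sum_add_distrib,
      this]
    ring
  have h1 : |(f.restrict i b).mean - f.mean| ≤ f.influence i := by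
    rw [hm, influence_eq_cubeProb, cubeProb_eq_cubeAvg, abs_le, ← neg_one_mul, ← cubeAvg_mul]
    refine ⟨cubeAvg_mono fun x => ?_, cubeAvg_mono fun x => ?_⟩
    · have := (abs_le.1 (key x)).1
      linarith
    · exact (abs_le.1 (key x)).2
  have h2 := abs_sub_abs_le_abs_sub (f.restrict i b).mean f.mean
  linarith

/-- The subcube has half of the measure, so it can at most double the density of sensitive points.
-/
theorem influence_restrict_le (f : BoolFun n) (i j : Fin n) (b : Bool) :
    (f.restrict i b).influence j ≤ 2 * f.influence j := by
  by_cases hij : j = i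
  · subst hij
    have : (f.restrict j b).influence j = 0 := by
      simp [influence, restrict]
    rw [this]
    linarith [f.influence_nonneg j]
  · classical
    let φ : (Fin n → Bool) → ℝ := fun x =>
      if x ∈ {x | f x ≠ f (Function.update x j (!(x j)))} then 1 else 0
    have hφ : ∀ x, 0 ≤ φ x := fun x => by dsimp only [φ]; split_ifs <;> norm_num
    have h1 : (f.restrict i b).influence j = cubeAvg fun x => φ (Function.update x i b) := by
      rw [influence_eq_cubeProb, cubeProb_eq_cubeAvg]
      congr 1
      ext x
      simp only [φ, restrict, Set.mem_ofPred_eq, Function.update_of_ne hij,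
        Function.update_comm hij]
    have h2 : f.influence j = cubeAvg φ := by
      rw [influence_eq_cubeProb, cubeProb_eq_cubeAvg]
    have h3 := cubeAvg_update φ i
    have h4 := cubeAvg_nonneg fun x => hφ (Function.update x i false)
    have h5 := cubeAvg_nonneg fun x => hφ (Function.update x i true)
    rw [h1, h2]
    cases b <;> linarith

end BoolFun

/-! ### Costs and errors of strategies; the potential argument. -/

namespace Strategy

theorem cost_nonneg (c : Fin n → ℕ) (S : Strategy n) (x : Fin n → Bool) : 0 ≤ S.cost c x := by
  induction S with
  | output b => exact le_rfl
  | query i t u ht hu =>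
    simp only [cost]
    cases x i <;> simp only [cond_true, cond_false] <;> positivity
  | flip p t u ht hu =>
    have := p.2.1
    have := sub_nonneg.2 p.2.2
    simp only [cost]
    positivity

theorem errorAt_nonneg (f : BoolFun n) (S : Strategy n) (x : Fin n → Bool) :
    0 ≤ S.errorAt f x := by
  induction S with
  | output b => simp only [errorAt]; split_ifs <;> norm_num
  | query i t u ht hu =>
    simp only [errorAt]
    cases x i <;> assumption
  | flip p t u ht hu =>
    have := p.2.1
    have := sub_nonneg.2 p.2.2
    simp only [errorAt]
    positivity

theorem error_output_eq_mean (f : BoolFun n) (b : ℤˣ) :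
    (output b).error f = (1 - ((b : ℤ) : ℝ) * f.mean) / 2 := by
  have h : ∀ x, (output b).errorAt f x = 1 / 2 + (-(((b : ℤ) : ℝ) / 2)) * ((f x : ℤ) : ℝ) := by
    intro x
    rcases Int.units_eq_one_or b with h1 | h1 <;>
      rcases Int.units_eq_one_or (f x) with h2 | h2 <;>
      simp [errorAt, h1, h2] <;> norm_num
  change cubeAvg (fun x => (output b).errorAt f x) = _
  rw [funext h, cubeAvg_add, cubeAvg_const, cubeAvg_mul]
  change _ + _ * f.mean = _
  ring

theorem error_output_eq_cubeProb (f : BoolFun n) (b : ℤˣ) :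
    (output b).error f = cubeProb {x | f x ≠ b} := by
  rw [cubeProb_eq_cubeAvg]
  change cubeAvg _ = _
  congr 1
  ext x
  by_cases h : b = f x <;> simp [errorAt, h, eq_comm]

/-- The input that agrees with the partial assignment `ρ` and elsewhere with `x`. -/
def fill (ρ : Fin n → Option Bool) (x : Fin n → Bool) : Fin n → Bool :=
  fun i => (ρ i).getD (x i)

theorem fill_update_of_none {ρ : Fin n → Option Bool} {i : Fin n} (h : ρ i = none) (b : Bool)
    (x : Fin n → Bool) :
    fill ρ (Function.update x i b) = fill (Function.update ρ i (some b)) x := by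
  funext j
  by_cases hj : j = i
  · subst hj; simp [fill, h]
  · simp [fill, hj]

theorem fill_update_of_some {ρ : Fin n → Option Bool} {i : Fin n} {c : Bool}
    (h : ρ i = some c) (b : Bool) (x : Fin n → Bool) :
    fill ρ (Function.update x i b) = fill ρ x := by
  funext j
  by_cases hj : j = i
  · subst hj; simp [fill, h]
  · simp [fill, hj]

/-- If the invariant `G` survives `k` admissible queries, and forces error at least `v` when the
strategy stops, then error less than `v` costs about `k` queries. -/
theorem le_error_add_cost_fill (G : ℕ → BoolFun n → Prop) (Adm : BoolFun n → Strategy n → Prop)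
    (v β : ℝ) (hβ : 0 ≤ β)
    (hout : ∀ k g b, G k g → v ≤ (output b).error g)
    (hflip : ∀ g p t u, Adm g (flip p t u) → Adm g t ∧ Adm g u)
    (hquery : ∀ k g i t u, G (k + 1) g → Adm g (query i t u) →
      (∀ b, G k (g.restrict i b)) ∧ Adm (g.restrict i false) t ∧ Adm (g.restrict i true) u)
    (f : BoolFun n) (S : Strategy n) :
    ∀ (k : ℕ) (ρ : Fin n → Option Bool), β * k ≤ v → G k (fun x => f (fill ρ x)) →
      Adm (fun x => f (fill ρ x)) S →
      β * k ≤ cubeAvg (fun x => S.errorAt f (fill ρ x) +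
        β * S.cost (unitCost n) (fill ρ x)) := by
  -- The answers are kept in `ρ`, and inputs are averaged after `fill ρ`, because a subtree may
  -- query a coordinate again and must then receive the same answer. Such a repeated query costs one
  -- and leaves the restriction unchanged.
  induction S with
  | output b =>
    intro k ρ hk hG hA
    refine hk.trans ((hout k _ b hG).trans (le_of_eq ?_))
    simp only [cost, mul_zero, add_zero]
    rfl
  | flip p t u ht hu =>
    intro k ρ hk hG hA
    obtain ⟨hAt, hAu⟩ := hflip _ _ _ _ hA
    have h1 := mul_le_mul_of_nonneg_left (ht k ρ hk hG hAt) p.2.1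
    have h2 := mul_le_mul_of_nonneg_left (hu k ρ hk hG hAu) (sub_nonneg.2 p.2.2)
    rw [← cubeAvg_mul] at h1 h2
    have h3 := add_le_add h1 h2
    rw [← cubeAvg_add] at h3
    calc β * k = p * (β * k) + (1 - p) * (β * k) := by ring
      _ ≤ _ := h3
      _ = _ := by
        congr 1
        ext x
        simp only [errorAt, cost]
        ring
  | query i t u ht hu =>
    intro k ρ hk hG hA
    cases k with
    | zero =>
      rw [Nat.cast_zero, mul_zero]
      exact cubeAvg_nonneg fun x => add_nonneg (errorAt_nonneg _ _ _)
        (mul_nonneg hβ (cost_nonneg _ _ _))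
    | succ k =>
      obtain ⟨hG', hAt, hAu⟩ := hquery k _ i t u hG hA
      have hk' : β * k ≤ v := by
        push_cast at hk
        linarith
      have hcast : β * ((k + 1 : ℕ) : ℝ) = β + β * k := by push_cast; ring
      rw [hcast]
      cases hi : ρ i with
      | none =>
        have hr : ∀ b, BoolFun.restrict (fun x => f (fill ρ x)) i b =
            fun x => f (fill (Function.update ρ i (some b)) x) := by
          intro b
          funext x
          simp only [BoolFun.restrict, fill_update_of_none hi]
        have h0 := hG' false
        have h1 := hG' true
        rw [hr] at h0 h1 hAt hAu
        have e0 := ht k _ hk' h0 hAt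
        have e1 := hu k _ hk' h1 hAu
        have hs := cubeAvg_update (fun x => (query i t u).errorAt f (fill ρ x) +
          β * (query i t u).cost (unitCost n) (fill ρ x)) i
        simp only [fill_update_of_none hi] at hs
        have c0 : (cubeAvg fun x => (query i t u).errorAt f
              (fill (Function.update ρ i (some false)) x) +
            β * (query i t u).cost (unitCost n) (fill (Function.update ρ i (some false)) x)) =
            β + cubeAvg fun x => t.errorAt f (fill (Function.update ρ i (some false)) x) +
              β * t.cost (unitCost n) (fill (Function.update ρ i (some false)) x) := by
          rw [← cubeAvg_const (n := n) β, ← cubeAvg_add, cubeAvg_const]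
          congr 1
          ext x
          have : fill (Function.update ρ i (some false)) x i = false := by simp [fill]
          simp only [errorAt, cost, this, cond_false, unitCost, Nat.cast_one]
          ring
        have c1 : (cubeAvg fun x => (query i t u).errorAt f
              (fill (Function.update ρ i (some true)) x) +
            β * (query i t u).cost (unitCost n) (fill (Function.update ρ i (some true)) x)) =
            β + cubeAvg fun x => u.errorAt f (fill (Function.update ρ i (some true)) x) +
              β * u.cost (unitCost n) (fill (Function.update ρ i (some true)) x) := by
          rw [← cubeAvg_const (n := n) β, ← cubeAvg_add, cubeAvg_const]
          congr 1
          ext x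
          have : fill (Function.update ρ i (some true)) x i = true := by simp [fill]
          simp only [errorAt, cost, this, cond_true, unitCost, Nat.cast_one]
          ring
        rw [c0, c1] at hs
        linarith
      | some c =>
        have hr : ∀ b, BoolFun.restrict (fun x => f (fill ρ x)) i b =
            fun x => f (fill ρ x) := by
          intro b
          funext x
          simp only [BoolFun.restrict, fill_update_of_some hi]
        have hG0 := hG' false
        rw [hr] at hG0 hAt hAu
        have hc : ∀ x, fill ρ x i = c := by intro x; simp [fill, hi]
        have e0 := ht k _ hk' hG0 hAt
        have e1 := hu k _ hk' hG0 hAu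
        have c0 : (cubeAvg fun x => (query i t u).errorAt f (fill ρ x) +
            β * (query i t u).cost (unitCost n) (fill ρ x)) =
            β + cubeAvg fun x => (bif c then u else t).errorAt f (fill ρ x) +
              β * (bif c then u else t).cost (unitCost n) (fill ρ x) := by
          rw [← cubeAvg_const (n := n) β, ← cubeAvg_add, cubeAvg_const]
          congr 1
          ext x
          simp only [errorAt, cost, hc, unitCost, Nat.cast_one]
          cases c <;> simp only [cond_true, cond_false] <;> ring
        rw [c0]
        cases c <;> simp only [cond_true, cond_false] <;> linarith

theorem le_error_add_cost (G : ℕ → BoolFun n → Prop) (Adm : BoolFun n → Strategy n → Prop)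
    (v β : ℝ) (hβ : 0 ≤ β)
    (hout : ∀ k g b, G k g → v ≤ (output b).error g)
    (hflip : ∀ g p t u, Adm g (flip p t u) → Adm g t ∧ Adm g u)
    (hquery : ∀ k g i t u, G (k + 1) g → Adm g (query i t u) →
      (∀ b, G k (g.restrict i b)) ∧ Adm (g.restrict i false) t ∧ Adm (g.restrict i true) u)
    {f : BoolFun n} {S : Strategy n} {k : ℕ} (hk : β * k ≤ v) (hG : G k f) (hA : Adm f S) :
    β * k ≤ S.error f + β * S.expectedCost (unitCost n) := by
  have h := le_error_add_cost_fill G Adm v β hβ hout hflip hquery f S k (fun _ => none) hk hG hA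
  rw [cubeAvg_add, cubeAvg_mul] at h
  exact h

/-- A function with small influences has no cheap strategy of small error. -/
theorem le_error_add_cost_of_influence_le {f : BoolFun n} {δ v β : ℝ} {d : ℕ} (hβ : 0 ≤ β)
    (hδ : ∀ i, f.influence i ≤ δ) (hmean : |f.mean| + (2 ^ d - 1) * δ ≤ 1 - 2 * v)
    (hd : β * d ≤ v) (hδ0 : 0 ≤ δ) (S : Strategy n) :
    β * d ≤ S.error f + β * S.expectedCost (unitCost n) := by
  -- With `k` queries left, `η` bounds the influences. A query replaces `η` by `2 * η` and adds at
  -- most `η` to `|mean|`, and `η + (2 ^ k - 1) * (2 * η) = (2 ^ (k + 1) - 1) * η`, so the bound is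
  -- preserved exactly.
  refine le_error_add_cost (fun k g => ∃ η : ℝ, 0 ≤ η ∧ (∀ i, g.influence i ≤ η) ∧
      |g.mean| + (2 ^ k - 1) * η ≤ 1 - 2 * v) (fun _ _ => True) v β hβ ?_
    (fun _ _ _ _ _ => ⟨trivial, trivial⟩) ?_ hd ⟨δ, hδ0, hδ, hmean⟩ trivial
  · rintro k g b ⟨η, hη0, -, hη⟩
    rw [error_output_eq_mean]
    have h2 : (1 : ℝ) ≤ 2 ^ k := one_le_pow₀ (by norm_num)
    have h3 : 0 ≤ ((2 : ℝ) ^ k - 1) * η := mul_nonneg (by linarith) hη0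
    have h4 : ((b : ℤ) : ℝ) * g.mean ≤ |g.mean| := by
      rcases Int.units_eq_one_or b with h | h
      · simpa [h] using le_abs_self g.mean
      · simpa [h] using neg_le_abs g.mean
    linarith
  · rintro k g i t u ⟨η, hη0, hinf, hη⟩ -
    refine ⟨fun b => ⟨2 * η, by positivity, fun j => ?_, ?_⟩, trivial, trivial⟩
    · exact (g.influence_restrict_le i j b).trans (by linarith [hinf j])
    · have h1 := g.abs_mean_restrict_le i b
      have h2 := hinf i
      rw [pow_succ] at hη
      linarith

/-- The strategy that queries the coordinates in the list `l`, collects the answers in `a`, and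
outputs the value of `f` there. -/
def readAll (f : BoolFun n) : List (Fin n) → (Fin n → Bool) → Strategy n
  | [], a => output (f a)
  | i :: l, a => query i (readAll f l (Function.update a i false))
      (readAll f l (Function.update a i true))

theorem cost_readAll (f : BoolFun n) (l : List (Fin n)) (a x : Fin n → Bool) :
    (readAll f l a).cost (unitCost n) x = l.length := by
  induction l generalizing a with
  | nil => simp [readAll, cost]
  | cons i l ih =>
    simp only [readAll, cost, ih, unitCost, List.length_cons]
    cases x i <;> simp [add_comm]

theorem errorAt_readAll (f g : BoolFun n) (l : List (Fin n)) (a x : Fin n → Bool) :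
    (readAll f l a).errorAt g x = if f (fun i => if i ∈ l then x i else a i) = g x then 0 else 1 := by
  induction l generalizing a with
  | nil => simp [readAll, errorAt]
  | cons i l ih =>
    have : ∀ b, x i = b → (fun j => if j ∈ l then x j else Function.update a i b j) =
        fun j => if j ∈ i :: l then x j else a j := by
      intro b hb
      funext j
      by_cases hj : j = i
      · subst hj; simp [hb]
      · simp [hj]
    simp only [readAll, errorAt, ih]
    cases hx : x i <;> simp only [cond_true, cond_false, this _ hx]

theorem optCost_le (f : BoolFun n) (c : Fin n → ℕ) {ε : ℝ} {S : Strategy n} (h : S.error f ≤ ε) :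
    optCost f c ε ≤ S.expectedCost c := by
  refine csInf_le ⟨0, ?_⟩ ⟨S, h, rfl⟩
  rintro r ⟨S, -, rfl⟩
  exact cubeAvg_nonneg fun x => cost_nonneg c S x

theorem isMaxCostWeighted_unitCost {f : BoolFun n} {i : Fin n}
    (h : f.IsMaxCostWeighted (unitCost n) i) : f.IsMostInfluential i := by
  intro j
  simpa [unitCost] using h j

/-- This makes the first claim of the theorem a case of the second: with unit costs the weighting
disappears, and the coin and the stopping rule are unrestricted. -/
theorem IsSStarFrom.queriesMostInfluential {B : ℝ} {f : BoolFun n} {Q : Finset (Fin n)} {k : ℕ}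
    {S : Strategy n} (h : IsSStarFrom (unitCost n) B f Q k S) : S.QueriesMostInfluential f := by
  induction h with
  | halt => trivial
  | last f Q k i p b b₀ b₁ hk hiQ hi =>
    exact ⟨⟨isMaxCostWeighted_unitCost hi, trivial, trivial⟩, trivial⟩
  | step f Q k i t₀ t₁ hiQ hi hk h₀ h₁ ih₀ ih₁ =>
    exact ⟨isMaxCostWeighted_unitCost hi, ih₀, ih₁⟩

end Strategy

end Averages

/-! ### Functions of disjoint blocks of coordinates. -/

section Blocks

variable {n : ℕ} {J : Type}

theorem ncard_exists_false (ι : Type) [Fintype ι] :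
    ({u | ∃ i, u i = false} : Set (ι → Bool)).ncard = (2 : ℝ) ^ Fintype.card ι - 1 := by
  classical
  have h : ({u | ∃ i, u i = false} : Set (ι → Bool)) = {fun _ => true}ᶜ := by
    ext u
    simp [funext_iff]
  have h2 := Set.ncard_add_ncard_compl ({fun _ => true} : Set (ι → Bool))
  rw [Set.ncard_singleton, ← h, Nat.card_eq_fintype_card] at h2
  have h3 : Fintype.card (ι → Bool) = 2 ^ Fintype.card ι := by simp
  rw [h3] at h2
  have h4 : ((1 + ({u | ∃ i, u i = false} : Set (ι → Bool)).ncard : ℕ) : ℝ) =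
      ((2 ^ Fintype.card ι : ℕ) : ℝ) := by rw [h2]
  push_cast at h4
  linarith

theorem ncard_forall_ne_true (ι : Type) [DecidableEq ι] (i₀ : ι) :
    ({u | ∀ i, i ≠ i₀ → u i = true} : Set (ι → Bool)).ncard = 2 := by
  have h : ({u | ∀ i, i ≠ i₀ → u i = true} : Set (ι → Bool)) =
      {fun _ => true, Function.update (fun _ => true) i₀ false} := by
    ext u
    simp only [Set.mem_ofPred_eq, Set.mem_insert_iff, Set.mem_singleton_iff, funext_iff]
    constructor
    · intro hu
      cases h0 : u i₀ with
      | true =>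
        left
        intro i
        by_cases hi : i = i₀
        · rw [hi, h0]
        · exact hu i hi
      | false =>
        right
        intro i
        by_cases hi : i = i₀
        · rw [hi, h0, Function.update_self]
        · rw [hu i hi, Function.update_of_ne hi]
    · rintro (hu | hu) i hi
      · exact hu i
      · rw [hu i, Function.update_of_ne hi]
  rw [h, Set.ncard_pair]
  intro h
  simpa using congrFun h i₀

/-- All coordinates in the block `j` are true. -/
def BlockTrue (blk : Fin n → J) (z : Fin n → Bool) (j : J) : Prop :=
  ∀ i, blk i = j → z i = true

/-- All coordinates in the block of `i`, except possibly `i` itself, are true. -/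
def OthersTrue (blk : Fin n → J) (z : Fin n → Bool) (i : Fin n) : Prop :=
  ∀ i', i' ≠ i → blk i' = blk i → z i' = true

theorem blockTrue_update_of_ne {blk : Fin n → J} {z : Fin n → Bool} {i : Fin n} {j : J}
    (h : blk i ≠ j) (b : Bool) : BlockTrue blk (Function.update z i b) j ↔ BlockTrue blk z j := by
  refine forall₂_congr fun i' hi' => ?_
  rw [Function.update_of_ne]
  rintro rfl
  exact h hi'

theorem othersTrue_update_self {blk : Fin n → J} {z : Fin n → Bool} {i : Fin n} (b : Bool) :
    OthersTrue blk (Function.update z i b) i ↔ OthersTrue blk z i := by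
  refine forall₂_congr fun i' hi' => ?_
  rw [Function.update_of_ne hi']

theorem othersTrue_update_of_ne {blk : Fin n → J} {z : Fin n → Bool} {i i' : Fin n}
    (h : blk i ≠ blk i') (b : Bool) :
    OthersTrue blk (Function.update z i b) i' ↔ OthersTrue blk z i' := by
  refine forall₂_congr fun k _ => forall_congr' fun hk => ?_
  rw [Function.update_of_ne]
  rintro rfl
  exact h hk

theorem BlockTrue.othersTrue {blk : Fin n → J} {z : Fin n → Bool} {i : Fin n}
    (h : BlockTrue blk z (blk i)) : OthersTrue blk z i := fun i' _ hi' => h i' hi'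

theorem OthersTrue.blockTrue_iff {blk : Fin n → J} {z : Fin n → Bool} {i : Fin n}
    (h : OthersTrue blk z i) : BlockTrue blk z (blk i) ↔ z i = true := by
  refine ⟨fun h' => h' i rfl, fun h' i' hi' => ?_⟩
  by_cases hi : i' = i
  · rw [hi, h']
  · exact h i' hi hi'

open Classical in
/-- The parity of the number of all-true blocks in `Y`. -/
noncomputable def blockSign (blk : Fin n → J) (Y : Finset J) : BoolFun n := fun z =>
  ∏ j ∈ Y, if BlockTrue blk z j then -1 else 1

open Classical in
theorem blockSign_congr {blk : Fin n → J} {Y : Finset J} {z z' : Fin n → Bool}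
    (hb : ∀ j ∈ Y, BlockTrue blk z j ↔ BlockTrue blk z' j) :
    blockSign blk Y z = blockSign blk Y z' :=
  Finset.prod_congr rfl fun j hj => if_congr (hb j hj) rfl rfl

variable [DecidableEq J]

/-- The number of coordinates in a block. -/
def blockSize (blk : Fin n → J) (j : J) : ℕ := Fintype.card {i // blk i = j}

/-- If another coordinate of the block of `i` is false, that block fails whatever the value at `i`;
other blocks do not contain `i`. -/
theorem blockTrue_update_iff {blk : Fin n → J} {z : Fin n → Bool} {i : Fin n}
    (h : ¬ OthersTrue blk z i) (b : Bool) (j : J) :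
    BlockTrue blk (Function.update z i b) j ↔ BlockTrue blk z j := by
  by_cases hj : blk i = j
  · subst hj
    refine iff_of_false (fun h' => h ?_) (fun h' => h h'.othersTrue)
    exact (othersTrue_update_self b).1 h'.othersTrue
  · exact blockTrue_update_of_ne hj b

open Classical in
/-- `1` if some block in `A` is all true; else `-1` if some block in `B` is all true; else `h`. -/
noncomputable def hybrid (blk : Fin n → J) (A B : Finset J) (h : BoolFun n) : BoolFun n := fun z =>
  if ∃ j ∈ A, BlockTrue blk z j then 1 else if ∃ j ∈ B, BlockTrue blk z j then -1 else h z

open Classical in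
theorem hybrid_congr {blk : Fin n → J} {A B : Finset J} {h h' : BoolFun n} {z z' : Fin n → Bool}
    (hb : ∀ j ∈ A ∪ B, BlockTrue blk z j ↔ BlockTrue blk z' j) (hh : h z = h' z') :
    hybrid blk A B h z = hybrid blk A B h' z' := by
  have hA : (∃ j ∈ A, BlockTrue blk z j) ↔ ∃ j ∈ A, BlockTrue blk z' j :=
    exists_congr fun j => and_congr_right fun hj => hb j (Finset.mem_union_left _ hj)
  have hB : (∃ j ∈ B, BlockTrue blk z j) ↔ ∃ j ∈ B, BlockTrue blk z' j :=
    exists_congr fun j => and_congr_right fun hj => hb j (Finset.mem_union_right _ hj)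
  exact if_congr hA rfl (if_congr hB rfl hh)

theorem hybrid_eq_of_forall_not {blk : Fin n → J} {A B : Finset J} {h : BoolFun n}
    {z : Fin n → Bool} (hz : ∀ j ∈ A ∪ B, ¬ BlockTrue blk z j) : hybrid blk A B h z = h z := by
  have hA : ¬ ∃ j ∈ A, BlockTrue blk z j := by
    rintro ⟨j, hj, hj'⟩
    exact hz j (Finset.mem_union_left _ hj) hj'
  have hB : ¬ ∃ j ∈ B, BlockTrue blk z j := by
    rintro ⟨j, hj, hj'⟩
    exact hz j (Finset.mem_union_right _ hj) hj'
  simp only [hybrid, hA, hB, if_false]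

theorem restrict_hybrid {blk : Fin n → J} {A B : Finset J} {h : BoolFun n} {i : Fin n}
    (hi : blk i ∉ A ∪ B) (b : Bool) :
    (hybrid blk A B h).restrict i b = hybrid blk A B (h.restrict i b) := by
  funext z
  have hb : ∀ j ∈ A ∪ B, BlockTrue blk (Function.update z i b) j ↔ BlockTrue blk z j :=
    fun j hj => blockTrue_update_of_ne (ne_of_mem_of_not_mem hj hi).symm b
  exact hybrid_congr hb rfl

-- Exactly one factor of the product changes sign.
open Classical in
theorem blockSign_flip_ne {blk : Fin n → J} {Y : Finset J} {z : Fin n → Bool} {i : Fin n}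
    (hi : blk i ∈ Y) (hz : OthersTrue blk z i) :
    blockSign blk Y (Function.update z i (!(z i))) ≠ blockSign blk Y z := by
  have h1 := (othersTrue_update_self (!(z i))).2 hz
  have h2 : ∏ j ∈ Y.erase (blk i), (if BlockTrue blk (Function.update z i (!(z i))) j then
      (-1 : ℤˣ) else 1) = ∏ j ∈ Y.erase (blk i), (if BlockTrue blk z j then -1 else 1) := by
    refine Finset.prod_congr rfl fun j hj => ?_
    simp only [blockTrue_update_of_ne (Finset.ne_of_mem_erase hj).symm]
  unfold blockSign
  rw [← Finset.mul_prod_erase Y _ hi, ← Finset.mul_prod_erase Y _ hi, h2]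
  simp only [h1.blockTrue_iff, hz.blockTrue_iff, Function.update_self, ne_eq, mul_left_inj]
  cases z i <;> simp

/-! ### Errors, influences and costs of the hybrid. -/

section Mass

variable {blk : Fin n → J} {A B : Finset J}

/-- The blocks of `A` alone force the value `1`, and those of `B` in the absence of `A` force `-1`,
each with probability at least `v`. Since `h` plays no role, the bound survives every query outside
`A ∪ B`. -/
theorem le_error_hybrid {v : ℝ} (hAB : v ≤ cubeProb {z | ∀ j ∈ A, ¬ BlockTrue blk z j} -
      cubeProb {z | ∀ j ∈ A ∪ B, ¬ BlockTrue blk z j})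
    (hA : cubeProb {z | ∀ j ∈ A, ¬ BlockTrue blk z j} ≤ 1 - v) (h : BoolFun n) (b : ℤˣ) :
    v ≤ (Strategy.output b).error (hybrid blk A B h) := by
  rw [Strategy.error_output_eq_cubeProb]
  rcases Int.units_eq_one_or b with rfl | rfl
  · refine hAB.trans ?_
    rw [← cubeProb_diff]
    · refine cubeProb_mono ?_
      rintro z ⟨hz1, hz2⟩
      have h1 : ¬ ∃ j ∈ A, BlockTrue blk z j := by
        rintro ⟨j, hj, hj'⟩
        exact hz1 j hj hj'
      have h2 : ∃ j ∈ B, BlockTrue blk z j := by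
        by_contra! h2
        refine hz2 fun j hj => ?_
        rcases Finset.mem_union.1 hj with hj | hj
        · exact hz1 j hj
        · exact h2 j hj
      simp only [Set.mem_ofPred_eq, hybrid, h1, h2, if_true, if_false]
      decide
    · exact fun z hz j hj => hz j (Finset.mem_union_left _ hj)
  · have h1 := cubeProb_compl {z : Fin n → Bool | ∀ j ∈ A, ¬ BlockTrue blk z j}
    have h2 : cubeProb {z : Fin n → Bool | ∀ j ∈ A, ¬ BlockTrue blk z j}ᶜ ≤
        cubeProb {z | hybrid blk A B h z ≠ -1} := by
      refine cubeProb_mono fun z hz => ?_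
      have h1 : ∃ j ∈ A, BlockTrue blk z j := by
        by_contra! h1
        exact hz h1
      simp only [Set.mem_ofPred_eq, hybrid, h1, if_true]
      decide
    linarith

variable [Fintype J]

/-- Events that depend on different blocks of coordinates are independent. -/
theorem cubeProb_blocks (blk : Fin n → J) (E : ∀ j, Set ({i // blk i = j} → Bool)) :
    cubeProb {z : Fin n → Bool | ∀ j, (fun i : {i // blk i = j} => z i) ∈ E j} =
      ∏ j, ((E j).ncard : ℝ) / 2 ^ Fintype.card {i // blk i = j} := by
  let Φ : (Fin n → Bool) ≃ (∀ j, {i // blk i = j} → Bool) :=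
    ((Equiv.sigmaFiberEquiv blk).arrowCongr (Equiv.refl Bool)).symm.trans
      (Equiv.piCurry fun j (_ : {i // blk i = j}) => Bool)
  have h1 : ({z : Fin n → Bool | ∀ j, (fun i : {i // blk i = j} => z i) ∈ E j}).ncard =
      ∏ j, (E j).ncard := by
    have e : {z : Fin n → Bool | ∀ j, (fun i : {i // blk i = j} => z i) ∈ E j} ≃ ∀ j, E j :=
      (Equiv.subtypeEquiv Φ fun z => Iff.rfl).trans
        (Equiv.subtypePiEquivPi (p := fun j u => u ∈ E j))
    rw [← Nat.card_coe_set_eq, Nat.card_congr e, Nat.card_pi]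
    simp only [Nat.card_coe_set_eq]
  have h2 : n = ∑ j, Fintype.card {i // blk i = j} := by
    rw [← Fintype.card_sigma, Fintype.card_congr (Equiv.sigmaFiberEquiv blk), Fintype.card_fin]
  rw [Finset.prod_div_distrib, Finset.prod_pow_eq_pow_sum, ← h2, cubeProb, h1]
  push_cast
  rfl

theorem cubeProb_forall_not_blockTrue (blk : Fin n → J) (C : Finset J) :
    cubeProb {z | ∀ j ∈ C, ¬ BlockTrue blk z j} =
      ∏ j ∈ C, (1 - 1 / (2 : ℝ) ^ blockSize blk j) := by
  have h : {z : Fin n → Bool | ∀ j ∈ C, ¬ BlockTrue blk z j} =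
      {z | ∀ j, (fun i : {i // blk i = j} => z i) ∈ {u | j ∈ C → ∃ i, u i = false}} := by
    ext z
    simp [BlockTrue]
  rw [h, cubeProb_blocks, ← Finset.prod_ite_mem_eq (s := C)]
  refine Finset.prod_congr rfl fun j _ => ?_
  split_ifs with hj
  · simp only [hj, forall_const]
    rw [ncard_exists_false, sub_div, div_self (by positivity)]
    rfl
  · simp [hj, Set.ncard_univ]

theorem cubeProb_and_othersTrue (blk : Fin n → J) {C : Finset J} {i₀ : Fin n}
    (hi₀ : blk i₀ ∉ C) :
    cubeProb {z | (∀ j ∈ C, ¬ BlockTrue blk z j) ∧ OthersTrue blk z i₀} =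
      (∏ j ∈ C, (1 - 1 / (2 : ℝ) ^ blockSize blk j)) * (2 / 2 ^ blockSize blk (blk i₀)) := by
  have h : {z : Fin n → Bool | (∀ j ∈ C, ¬ BlockTrue blk z j) ∧ OthersTrue blk z i₀} =
      {z | ∀ j, (fun i : {i // blk i = j} => z i) ∈
        {u | (j ∈ C → ∃ i, u i = false) ∧
          (j = blk i₀ → ∀ i : {i // blk i = j}, i.1 ≠ i₀ → u i = true)}} := by
    ext z
    simp only [BlockTrue, OthersTrue, Set.mem_ofPred_eq, forall_and]
    refine and_congr (by simp) ⟨?_, ?_⟩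
    · rintro h j rfl i hi
      exact h i hi i.2
    · intro h i hi hij
      exact h _ rfl ⟨i, hij⟩ hi
  have hp : (∏ j ∈ C, (1 - 1 / (2 : ℝ) ^ blockSize blk j)) * (2 / 2 ^ blockSize blk (blk i₀)) =
      ∏ j, ((if j ∈ C then (1 - 1 / (2 : ℝ) ^ blockSize blk j) else 1) *
        if j = blk i₀ then 2 / 2 ^ blockSize blk j else 1) := by
    rw [Finset.prod_mul_distrib, Finset.prod_ite_mem_eq, Finset.prod_ite_eq' Finset.univ,
      if_pos (Finset.mem_univ _)]
  rw [h, cubeProb_blocks, hp]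
  refine Finset.prod_congr rfl fun j _ => ?_
  by_cases hj : j ∈ C
  · have hj0 : j ≠ blk i₀ := fun h => hi₀ (h ▸ hj)
    simp only [hj, hj0, forall_const, false_imp_iff, and_true, if_true, if_false, mul_one]
    rw [ncard_exists_false, sub_div, div_self (by positivity)]
    rfl
  · by_cases hj0 : j = blk i₀
    · subst hj0
      have := ncard_forall_ne_true {i // blk i = blk i₀} ⟨i₀, rfl⟩
      simp only [Ne, Subtype.ext_iff] at this
      simp only [hj, false_imp_iff, true_and, forall_const, if_true, if_false, one_mul, Ne, this]
      rfl
    · simp [hj, hj0, Set.ncard_univ]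

theorem cubeProb_othersTrue (blk : Fin n → J) (i : Fin n) :
    cubeProb {z | OthersTrue blk z i} = 2 / 2 ^ blockSize blk (blk i) := by
  simpa using cubeProb_and_othersTrue blk (Finset.notMem_empty (blk i))

theorem influence_le_of_othersTrue {blk : Fin n → J} {g : BoolFun n} {i : Fin n}
    (h : ∀ z, g z ≠ g (Function.update z i (!(z i))) → OthersTrue blk z i) :
    g.influence i ≤ 2 / 2 ^ blockSize blk (blk i) := by
  rw [g.influence_eq_cubeProb, ← cubeProb_othersTrue]
  exact cubeProb_mono h

/-- Greedy strategies never query the blocks in `A ∪ B` as long as another block is untouched. -/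
theorem le_error_add_cost_of_queriesMostInfluential {v β : ℝ}
    (hAB : v ≤ cubeProb {z | ∀ j ∈ A, ¬ BlockTrue blk z j} -
      cubeProb {z | ∀ j ∈ A ∪ B, ¬ BlockTrue blk z j})
    (hA : cubeProb {z | ∀ j ∈ A, ¬ BlockTrue blk z j} ≤ 1 - v)
    (hinf : ∀ i i', blk i ∈ A ∪ B → blk i' ∉ A ∪ B → 2 / 2 ^ blockSize blk (blk i) <
      cubeProb {z | ∀ j ∈ A ∪ B, ¬ BlockTrue blk z j} * (2 / 2 ^ blockSize blk (blk i')))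
    (hsurj : Function.Surjective blk) (hβ : 0 ≤ β) (hβv : β * ((A ∪ B)ᶜ.card : ℝ) ≤ v)
    {S : Strategy n} (hS : S.QueriesMostInfluential (hybrid blk A B (blockSign blk (A ∪ B)ᶜ))) :
    β * ((A ∪ B)ᶜ.card : ℝ) ≤ S.error (hybrid blk A B (blockSign blk (A ∪ B)ᶜ)) +
      β * S.expectedCost (unitCost n) := by
  -- Invariant: `T` contains the touched parity blocks, `h` is what remains of the parity. It
  -- ignores `A ∪ B` and is still flipped by each pivotal coordinate of an untouched block.
  refine Strategy.le_error_add_cost (fun k g => ∃ (T : Finset J) (h : BoolFun n),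
      T.card + k ≤ (A ∪ B)ᶜ.card ∧ g = hybrid blk A B h ∧
      (∀ i z b, blk i ∈ A ∪ B → h (Function.update z i b) = h z) ∧
      ∀ i z, blk i ∉ A ∪ B → blk i ∉ T → OthersTrue blk z i →
        h (Function.update z i (!(z i))) ≠ h z)
    (fun g S => S.QueriesMostInfluential g) v β hβ ?_ (fun _ _ _ _ h => h) ?_ hβv
    ⟨∅, _, by simp, rfl, ?_, ?_⟩ hS
  · rintro k g b ⟨T, h, -, rfl, -, -⟩
    exact le_error_hybrid hAB hA h b
  · rintro k g i t u ⟨T, h, hT, rfl, hX, hY⟩ ⟨hi, ht, hu⟩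
    refine ⟨fun b => ?_, ht, hu⟩
    have hiY : blk i ∉ A ∪ B := by
      intro hiX
      -- The counter is `k + 1` here, so `T` is strictly smaller than the set of parity blocks. A
      -- coordinate of an untouched block then has larger influence than `i`.
      obtain ⟨j, hj, hjT⟩ : ∃ j ∈ (A ∪ B)ᶜ, j ∉ T :=
        Finset.exists_mem_notMem_of_card_lt_card (by omega)
      obtain ⟨i', rfl⟩ := hsurj j
      have hi' : blk i' ∉ A ∪ B := Finset.mem_compl.1 hj
      have h1 : (hybrid blk A B h).influence i ≤ 2 / 2 ^ blockSize blk (blk i) := by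
        refine influence_le_of_othersTrue fun z hz => ?_
        by_contra hz'
        exact hz (hybrid_congr (fun j _ => (blockTrue_update_iff hz' _ j).symm)
          (hX i z _ hiX).symm)
      have h2 : cubeProb {z | ∀ j ∈ A ∪ B, ¬ BlockTrue blk z j} *
          (2 / 2 ^ blockSize blk (blk i')) ≤ (hybrid blk A B h).influence i' := by
        rw [cubeProb_forall_not_blockTrue, ← cubeProb_and_othersTrue blk hi',
          BoolFun.influence_eq_cubeProb]
        refine cubeProb_mono ?_
        rintro z ⟨hz1, hz2⟩
        rw [Set.mem_ofPred_eq, hybrid_eq_of_forall_not hz1, hybrid_eq_of_forall_not]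
        · exact (hY i' z hi' hjT hz2).symm
        · intro j hj
          rw [blockTrue_update_of_ne (ne_of_mem_of_not_mem hj hi').symm]
          exact hz1 j hj
      linarith [hi i', hinf i i' hiX hi']
    refine ⟨insert (blk i) T, h.restrict i b, ?_, restrict_hybrid hiY b, ?_, ?_⟩
    · have := Finset.card_insert_le (blk i) T
      omega
    · intro i' z b' hi'
      have hne : i ≠ i' := by
        rintro rfl
        exact hiY hi'
      simp only [BoolFun.restrict]
      rw [Function.update_comm hne.symm, hX i' _ b' hi']
    · intro i' z hi' hiT hz
      rw [Finset.mem_insert, not_or] at hiT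
      have hne : i' ≠ i := by
        rintro rfl
        exact hiT.1 rfl
      have := hY i' (Function.update z i b) hi' hiT.2
        ((othersTrue_update_of_ne (Ne.symm hiT.1) b).2 hz)
      simp only [BoolFun.restrict]
      rwa [Function.update_of_ne hne, Function.update_comm hne.symm] at this
  · intro i z b hi
    refine blockSign_congr fun j hj => blockTrue_update_of_ne ?_ b
    rintro rfl
    exact Finset.mem_compl.1 hj hi
  · intro i z hi _ hz
    exact blockSign_flip_ne (Finset.mem_compl.2 hi) hz

theorem influence_hybrid_blockSign_le (Y : Finset J) (i : Fin n) :
    (hybrid blk A B (blockSign blk Y)).influence i ≤ 2 / 2 ^ blockSize blk (blk i) := by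
  refine influence_le_of_othersTrue fun z hz => ?_
  by_contra hz'
  have := fun j => (blockTrue_update_iff hz' (!(z i)) j).symm
  exact hz (hybrid_congr (fun j _ => this j) (blockSign_congr fun j _ => this j))

theorem le_influence_hybrid_blockSign {i : Fin n} (hi : blk i ∉ A ∪ B) :
    cubeProb {z | ∀ j ∈ A ∪ B, ¬ BlockTrue blk z j} * (2 / 2 ^ blockSize blk (blk i)) ≤
      (hybrid blk A B (blockSign blk (A ∪ B)ᶜ)).influence i := by
  rw [cubeProb_forall_not_blockTrue, ← cubeProb_and_othersTrue blk hi,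
    BoolFun.influence_eq_cubeProb]
  refine cubeProb_mono ?_
  rintro z ⟨hz1, hz2⟩
  rw [Set.mem_ofPred_eq, hybrid_eq_of_forall_not hz1, hybrid_eq_of_forall_not]
  · exact (blockSign_flip_ne (Finset.mem_compl.2 hi) hz2).symm
  · intro j hj
    rw [blockTrue_update_of_ne (ne_of_mem_of_not_mem hj hi).symm]
    exact hz1 j hj

theorem sum_blocks (φ : J → ℝ) : ∑ i, φ (blk i) = ∑ j, (blockSize blk j : ℝ) * φ j := by
  rw [← Finset.sum_fiberwise (s := Finset.univ) (g := blk)]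
  refine Finset.sum_congr rfl fun j _ => ?_
  rw [Finset.sum_congr rfl (g := fun _ => φ j) fun i hi => by rw [(Finset.mem_filter.1 hi).2],
    Finset.sum_const, nsmul_eq_mul, blockSize, Fintype.card_subtype]

/-- Reading all blocks in `A ∪ B` is enough to evaluate the hybrid up to a small error. -/
theorem optCost_hybrid_le {ε : ℝ} (h : BoolFun n)
    (hε : cubeProb {z | ∀ j ∈ A ∪ B, ¬ BlockTrue blk z j} ≤ ε) :
    optCost (hybrid blk A B h) (unitCost n) ε ≤ ∑ j ∈ A ∪ B, (blockSize blk j : ℝ) := by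
  classical
  let l : List (Fin n) := (Finset.univ.filter fun i => blk i ∈ A ∪ B).toList
  let S := Strategy.readAll (hybrid blk A B h) l fun _ => false
  have hcost : S.expectedCost (unitCost n) = ∑ j ∈ A ∪ B, (blockSize blk j : ℝ) := by
    have h1 : S.expectedCost (unitCost n) = l.length := by
      change cubeAvg (fun x => S.cost (unitCost n) x) = _
      simp only [S, Strategy.cost_readAll, cubeAvg_const]
    have h2 := sum_blocks (blk := blk) fun j => if j ∈ A ∪ B then 1 else 0
    simp only [mul_ite, mul_one, mul_zero, Finset.sum_ite_mem_eq, Finset.sum_boole] at h2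
    rw [h1, ← h2, Finset.length_toList]
  rw [← hcost]
  refine Strategy.optCost_le _ _ (le_trans ?_ hε)
  rw [cubeProb_eq_cubeAvg]
  refine cubeAvg_mono fun x => ?_
  simp only [S, Strategy.errorAt_readAll]
  by_cases hx : ∀ j ∈ A ∪ B, ¬ BlockTrue blk x j
  · rw [if_pos (show x ∈ {z | ∀ j ∈ A ∪ B, ¬ BlockTrue blk z j} from hx)]
    split_ifs <;> norm_num
  -- Some block of `A ∪ B` is all true, so the value depends only on coordinates in `l`, and the
  -- output is correct.
  · rw [if_pos]
    · split_ifs <;> norm_num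
    · have hb : ∀ j ∈ A ∪ B, BlockTrue blk (fun i => if i ∈ l then x i else false) j ↔
          BlockTrue blk x j := by
        intro j hj
        refine forall₂_congr fun i hi => ?_
        have : i ∈ l := by simpa only [l, Finset.mem_toList, Finset.mem_filter_univ, hi] using hj
        simp only [this, if_true]
      have hA : (∃ j ∈ A, BlockTrue blk (fun i => if i ∈ l then x i else false) j) ↔
          ∃ j ∈ A, BlockTrue blk x j :=
        exists_congr fun j => and_congr_right fun hj => hb j (Finset.mem_union_left _ hj)
      have hB : (∃ j ∈ B, BlockTrue blk (fun i => if i ∈ l then x i else false) j) ↔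
          ∃ j ∈ B, BlockTrue blk x j :=
        exists_congr fun j => and_congr_right fun hj => hb j (Finset.mem_union_right _ hj)
      unfold hybrid
      simp only [hA, hB]
      split_ifs with h1 h2
      · rfl
      · rfl
      · refine absurd (fun j hj hj' => ?_) hx
        rcases Finset.mem_union.1 hj with hj | hj
        · exact h1 ⟨j, hj, hj'⟩
        · exact h2 ⟨j, hj, hj'⟩

end Mass

end Blocks

/-! ### The probability of missing all blocks, and the choice of parameters. -/

/-- The probability that none of `2 ^ w` independent events of probability `2 ^ (-w)` occurs. -/
noncomputable def missProb (w : ℕ) : ℝ := (1 - 1 / 2 ^ w) ^ 2 ^ w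

theorem one_div_two_pow_le_one (w : ℕ) : 1 / (2 : ℝ) ^ w ≤ 1 := by
  rw [div_le_one (by positivity)]
  exact one_le_pow₀ (by norm_num)

theorem missProb_nonneg (w : ℕ) : 0 ≤ missProb w :=
  pow_nonneg (sub_nonneg.2 (one_div_two_pow_le_one w)) _

theorem missProb_le_half (w : ℕ) : missProb w ≤ 1 / 2 := by
  have h1 : 1 - 1 / (2 : ℝ) ^ w ≤ Real.exp (-(1 / 2 ^ w)) := Real.one_sub_le_exp_neg _
  have h2 : missProb w ≤ Real.exp (-(1 / 2 ^ w)) ^ 2 ^ w :=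
    pow_le_pow_left₀ (sub_nonneg.2 (one_div_two_pow_le_one w)) h1 _
  rw [← Real.exp_nat_mul] at h2
  have h3 : ((2 ^ w : ℕ) : ℝ) * -(1 / 2 ^ w) = -1 := by
    push_cast
    field_simp
  rw [h3, Real.exp_neg] at h2
  refine h2.trans ?_
  rw [inv_le_comm₀ (Real.exp_pos 1) (by norm_num)]
  linarith [Real.exp_one_gt_d9]

/-- `missProb` increases with `w`, as `(1 - x / 2) ^ 2 ≥ 1 - x`; at `w = 3` it is `(7 / 8) ^ 8 >
0.343`. -/
theorem le_missProb {w : ℕ} (hw : 3 ≤ w) : 34 / 100 ≤ missProb w := by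
  induction w, hw using Nat.le_induction with
  | base => norm_num [missProb]
  | succ w hw ih =>
    refine ih.trans ?_
    unfold missProb
    rw [show (2 : ℕ) ^ (w + 1) = 2 * 2 ^ w by rw [pow_succ, mul_comm], pow_mul]
    refine pow_le_pow_left₀ (sub_nonneg.2 (one_div_two_pow_le_one w)) ?_ _
    rw [pow_succ (2 : ℝ) w, ← div_div, sub_sq]
    nlinarith [sq_nonneg (1 / (2 : ℝ) ^ w / 2)]

theorem exists_blocks {J : Type} [Fintype J] [DecidableEq J] (size : J → ℕ) :
    ∃ (n : ℕ) (blk : Fin n → J), ∀ j, blockSize blk j = size j := by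
  let e := (Fintype.equivFin (Σ j, Fin (size j))).symm
  refine ⟨_, fun i => (e i).1, fun j => ?_⟩
  have e' : {i // (e i).1 = j} ≃ Fin (size j) :=
    (e.subtypeEquiv fun i => Iff.rfl).trans (Equiv.sigmaSubtype j)
  rw [blockSize, Fintype.card_congr e', Fintype.card_fin]

theorem exists_disjoint_finsets (p q r : ℕ) :
    ∃ (J : Type) (_ : Fintype J) (_ : DecidableEq J) (A B : Finset J),
      A.card = p ∧ (A ∪ B).card = p + q ∧ (A ∪ B)ᶜ.card = r := by
  refine ⟨Fin p ⊕ (Fin q ⊕ Fin r), inferInstance, inferInstance,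
    Finset.univ.map Function.Embedding.inl,
    Finset.univ.map (Function.Embedding.inl.trans Function.Embedding.inr), by simp, ?_⟩
  have h : (Finset.univ.map Function.Embedding.inl ∪
      Finset.univ.map (Function.Embedding.inl.trans Function.Embedding.inr) :
        Finset (Fin p ⊕ (Fin q ⊕ Fin r))).card = p + q := by
    rw [Finset.card_union_of_disjoint]
    · simp
    · rw [Finset.disjoint_left]
      simp
  refine ⟨h, ?_⟩
  rw [Finset.card_compl, h]
  simp
  omega

/-- The shift `2 * b + 3` pays for the probability `missProb w ^ (b + 1) ≥ 2 ^ (-(2 * b + 2))` that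
the parity matters, with a factor `2` to spare for a strict gap in influence. The condition `4 ≤ b`
makes this probability at most `1 / 32`, so that `0.34 - 1 / 32 ≥ 3 / 10`. The parameter `d` only
serves to make the optimal cost large. -/
theorem exists_hard_function {b v d w : ℕ} (hw : w = v + (2 * b + 3)) {ε : ℝ} (hε : ε < 1 / 4)
    (hb : (1 / 2 : ℝ) ^ (b + 1) ≤ ε) (hb4 : 4 ≤ b) (hd : 0 < d) (hv : d + 7 ≤ v) :
    ∃ (n : ℕ) (f : BoolFun n), 2 ^ w ≤ f.totalInfluence ∧
      f.totalInfluence ≤ w * 2 ^ w * (2 * (1 + b) + 2 * 2 ^ (2 * b + 3)) ∧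
      optCost f (unitCost n) ε ≤ (1 + b) * 2 ^ w * w ∧
      (∀ S : Strategy n, S.error f ≤ ε → (d : ℝ) / 10 ≤ S.expectedCost (unitCost n)) ∧
      ∀ S : Strategy n, S.QueriesMostInfluential f → S.error f ≤ ε →
        (2 : ℝ) ^ w * 2 ^ w / 10 ≤ S.expectedCost (unitCost n) := by
  obtain ⟨J, _, _, A, B, hA, hAB, hY⟩ := exists_disjoint_finsets (2 ^ w) (b * 2 ^ w) (2 ^ w * 2 ^ w)
  obtain ⟨n, blk, hsize⟩ := exists_blocks fun j : J => if j ∈ A ∪ B then w else v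
  have hX' : ∀ j ∈ A ∪ B, blockSize blk j = w := fun j hj => by rw [hsize, if_pos hj]
  have hY' : ∀ j ∉ A ∪ B, blockSize blk j = v := fun j hj => by rw [hsize, if_neg hj]
  have hPA : cubeProb {z | ∀ j ∈ A, ¬ BlockTrue blk z j} = missProb w := by
    rw [cubeProb_forall_not_blockTrue, Finset.prod_congr rfl fun j hj => by
      rw [hX' j (Finset.mem_union_left _ hj)], Finset.prod_const, hA, missProb]
  have hPAB : cubeProb {z | ∀ j ∈ A ∪ B, ¬ BlockTrue blk z j} = missProb w ^ (b + 1) := by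
    rw [cubeProb_forall_not_blockTrue, Finset.prod_congr rfl fun j hj => by rw [hX' j hj],
      Finset.prod_const, hAB, missProb, ← pow_mul]
    congr 1
    ring
  have hm0 := missProb_nonneg w
  have hm1 := missProb_le_half w
  have hm2 : 34 / 100 ≤ missProb w := le_missProb (by omega)
  have hle : missProb w ^ (b + 1) ≤ (1 / 2) ^ (b + 1) := pow_le_pow_left₀ hm0 hm1 _
  have hle5 : (1 / 2 : ℝ) ^ (b + 1) ≤ (1 / 2) ^ 5 :=
    pow_le_pow_of_le_one (by norm_num) (by norm_num) (by omega)
  have hge : 1 / 2 ^ (2 * b + 2) ≤ missProb w ^ (b + 1) := by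
    have : (1 : ℝ) / 2 ^ (2 * b + 2) = (1 / 4) ^ (b + 1) := by
      rw [show 2 * b + 2 = 2 * (b + 1) by ring, pow_mul, div_pow, one_pow]
      norm_num
    rw [this]
    exact pow_le_pow_left₀ (by norm_num) (by linarith) _
  have h1 : (3 / 10 : ℝ) ≤ cubeProb {z | ∀ j ∈ A, ¬ BlockTrue blk z j} -
      cubeProb {z | ∀ j ∈ A ∪ B, ¬ BlockTrue blk z j} := by
    rw [hPA, hPAB]
    norm_num at hle5
    linarith
  have h2 : cubeProb {z | ∀ j ∈ A, ¬ BlockTrue blk z j} ≤ 1 - 3 / 10 := by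
    rw [hPA]
    linarith
  have hww : (2 : ℝ) ^ w = 2 ^ v * (2 * 2 ^ (2 * b + 2)) := by rw [hw]; ring
  have hgap : (2 : ℝ) * (2 / 2 ^ w) ≤ missProb w ^ (b + 1) * (2 / 2 ^ v) := by
    have : (2 : ℝ) * (2 / 2 ^ w) = 1 / 2 ^ (2 * b + 2) * (2 / 2 ^ v) := by
      rw [hww]
      field_simp
    rw [this]
    gcongr
  have hw0 : (0 : ℝ) < 2 / 2 ^ w := by positivity
  have hsurj : Function.Surjective blk := by
    intro j
    have : 0 < blockSize blk j := by
      rw [hsize]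
      split_ifs <;> omega
    obtain ⟨i, hi⟩ := Fintype.card_pos_iff.1 this
    exact ⟨i, hi⟩
  have hv1 : (1 : ℝ) ≤ v := by exact_mod_cast (by omega : 1 ≤ v)
  have hvw : (v : ℝ) ≤ w := by exact_mod_cast (by omega : v ≤ w)
  have hYr : ((A ∪ B)ᶜ.card : ℝ) = 2 ^ w * 2 ^ w := by rw [hY]; push_cast; rfl
  refine ⟨n, hybrid blk A B (blockSign blk (A ∪ B)ᶜ), ?_, ?_, ?_, ?_, ?_⟩
  -- The parity blocks suffice: `4 ^ w` blocks of `v` coordinates, each of influence at least `4 / 2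
  -- ^ w`.
  · have h3 : ∀ i, (if blk i ∈ (A ∪ B)ᶜ then 2 * (2 / (2 : ℝ) ^ w) else 0) ≤
        (hybrid blk A B (blockSign blk (A ∪ B)ᶜ)).influence i := by
      intro i
      split_ifs with hi
      · rw [Finset.mem_compl] at hi
        have := le_influence_hybrid_blockSign hi
        rw [hPAB, hY' _ hi] at this
        exact hgap.trans this
      · exact BoolFun.influence_nonneg _ i
    have h4 := Finset.sum_le_sum fun i (_ : i ∈ Finset.univ) => h3 i
    rw [sum_blocks (blk := blk) fun j =>
      if j ∈ (A ∪ B)ᶜ then 2 * (2 / (2 : ℝ) ^ w) else 0] at h4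
    simp only [mul_ite, mul_zero, Finset.sum_ite_mem_eq] at h4
    rw [Finset.sum_congr rfl fun j hj => by rw [hY' j (Finset.mem_compl.1 hj)],
      Finset.sum_const, nsmul_eq_mul, hYr] at h4
    refine le_trans ?_ h4
    have : (2 : ℝ) ^ w * 2 ^ w * (v * (2 * (2 / 2 ^ w))) = 2 ^ w * (4 * v) := by
      field_simp
      norm_num
    rw [this]
    nlinarith [pow_pos (show (0 : ℝ) < 2 by norm_num) w]
  · have h4 := Finset.sum_le_sum fun i (_ : i ∈ Finset.univ) =>
      influence_hybrid_blockSign_le (A := A) (B := B) (blk := blk) (A ∪ B)ᶜ i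
    rw [sum_blocks (blk := blk) fun j => (2 : ℝ) / 2 ^ blockSize blk j,
      ← Finset.sum_add_sum_compl (A ∪ B),
      Finset.sum_congr (s₁ := A ∪ B) rfl fun j hj => by rw [hX' j hj],
      Finset.sum_const, Finset.sum_congr (s₁ := (A ∪ B)ᶜ) rfl fun j hj => by
        rw [hY' j (Finset.mem_compl.1 hj)], Finset.sum_const, nsmul_eq_mul, nsmul_eq_mul,
      hYr, hAB] at h4
    refine h4.trans ?_
    have e1 : (((2 ^ w + b * 2 ^ w : ℕ) : ℝ)) * (w * (2 / 2 ^ w)) = w * (2 * (1 + b)) := by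
      push_cast
      field_simp
    have e2 : (2 : ℝ) ^ w * 2 ^ w * (v * (2 / 2 ^ v)) = v * 2 ^ w * (2 * 2 ^ (2 * b + 3)) := by
      nth_rewrite 2 [hww]
      rw [show 2 * b + 3 = 2 * b + 2 + 1 by ring, pow_succ (2 : ℝ) (2 * b + 2)]
      field_simp
    rw [e1, e2, mul_add ((w : ℝ) * 2 ^ w)]
    have h5 : (1 : ℝ) ≤ 2 ^ w := one_le_pow₀ (by norm_num)
    have h6 : (w : ℝ) ≤ w * 2 ^ w := le_mul_of_one_le_right (by positivity) h5
    gcongr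
  · have h3 := optCost_hybrid_le (blk := blk) (A := A) (B := B) (blockSign blk (A ∪ B)ᶜ)
      (hPAB.trans_le (hle.trans hb))
    rw [Finset.sum_congr rfl fun j hj => by rw [hX' j hj], Finset.sum_const, nsmul_eq_mul,
      hAB] at h3
    refine h3.trans (le_of_eq ?_)
    push_cast
    ring
  · intro S hS
    have e1 := le_error_hybrid h1 h2 (blockSign blk (A ∪ B)ᶜ) 1
    have e2 := le_error_hybrid h1 h2 (blockSign blk (A ∪ B)ᶜ) (-1)
    rw [Strategy.error_output_eq_mean] at e1 e2
    push_cast at e1 e2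
    have hd0 : (0 : ℝ) < d := by exact_mod_cast hd
    have hinf : ∀ i, (hybrid blk A B (blockSign blk (A ∪ B)ᶜ)).influence i ≤ 2 / 2 ^ v := by
      intro i
      refine (influence_hybrid_blockSign_le _ i).trans ?_
      have : v ≤ blockSize blk (blk i) := by
        rw [hsize]
        split_ifs <;> omega
      gcongr
      norm_num
    have hδ : (2 : ℝ) ^ d * (2 / 2 ^ v) ≤ 2 / 100 := by
      have : (2 : ℝ) ^ d * 2 ^ 7 ≤ 2 ^ v := by
        rw [← pow_add]
        exact pow_le_pow_right₀ (by norm_num) hv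
      rw [mul_div_assoc', div_le_iff₀ (by positivity)]
      have := pow_pos (show (0 : ℝ) < 2 by norm_num) d
      linarith
    have hmean : |(hybrid blk A B (blockSign blk (A ∪ B)ᶜ)).mean| ≤ 4 / 10 :=
      abs_le.2 ⟨by linarith, by linarith⟩
    have hδ0 : (0 : ℝ) < 2 / 2 ^ v := by positivity
    have hβ : (28 / 100 / d : ℝ) * d = 28 / 100 := by field_simp
    -- Here `1 - 2 * 0.28 = 0.44` leaves room for `|mean| ≤ 0.4` and a drift of at most `0.02`. The
    -- excess `0.28 - 1 / 4 = 0.03` of the error over `ε` then gives cost at least `(3 / 28) * d`.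
    have := Strategy.le_error_add_cost_of_influence_le (v := 28 / 100) (β := 28 / 100 / d)
      (by positivity) hinf (by linarith) hβ.le hδ0.le S
    rw [hβ, div_mul_eq_mul_div] at this
    have h3 : (3 / 100 : ℝ) ≤ 28 / 100 * S.expectedCost (unitCost n) / d := by linarith
    rw [le_div_iff₀ hd0] at h3
    linarith
  · intro S hS hSe
    have hr0 : (0 : ℝ) < 2 ^ w * 2 ^ w := by positivity
    have hβ : (3 / 10 / (2 ^ w * 2 ^ w) : ℝ) * (2 ^ w * 2 ^ w) = 3 / 10 := by field_simp
    have := le_error_add_cost_of_queriesMostInfluential (β := 3 / 10 / (2 ^ w * 2 ^ w)) h1 h2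
      (fun i i' hi hi' => by
        rw [hX' _ hi, hY' _ hi', hPAB]
        linarith) hsurj (by positivity) (by rw [hYr, hβ]) hS
    rw [hYr, hβ, div_mul_eq_mul_div] at this
    -- `3 / 10 - 1 / 4 = 5 / 100`, so the cost is at least `4 ^ w / 6`.
    have h3 : (5 / 100 : ℝ) ≤ 3 / 10 * S.expectedCost (unitCost n) / (2 ^ w * 2 ^ w) := by
      linarith
    rw [le_div_iff₀ hr0] at h3
    linarith

theorem mainTheorem8 :
    ∃ q : ℕ, ∀ ε : ℝ, 0 < ε → ε < 1 / 4 → ∃ C : ℝ, 0 < C ∧ ∀ K : ℝ,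
      ∃ (n : ℕ) (f : BoolFun n),
        K ≤ f.totalInfluence ∧ K ≤ optCost f (unitCost n) ε ∧
        (∀ (B : ℝ) (S : Strategy n), 0 ≤ B → S.IsSStar f (unitCost n) B → S.error f ≤ ε →
          optCost f (unitCost n) ε *
              (C * f.totalInfluence / Real.log (2 + f.totalInfluence) ^ q) ≤
            S.expectedCost (unitCost n)) ∧
        (∀ S : Strategy n, S.QueriesMostInfluential f → S.error f ≤ ε →
          optCost f (unitCost n) ε *
              (C * f.totalInfluence / Real.log (2 + f.totalInfluence) ^ q) ≤
            S.expectedCost (unitCost n)) := by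
  -- The bounds for the optimal cost and for the total influence each contain one factor `w`, and
  -- each is absorbed by one logarithm.
  refine ⟨2, fun ε hε0 hε => ?_⟩
  obtain ⟨m, hm⟩ := exists_pow_lt_of_lt_one hε0 (show (1 / 2 : ℝ) < 1 by norm_num)
  obtain ⟨b, hb4, hb⟩ : ∃ b : ℕ, 4 ≤ b ∧ (1 / 2 : ℝ) ^ (b + 1) ≤ ε :=
    ⟨m + 4, by omega, (pow_le_pow_of_le_one (by norm_num) (by norm_num) (by omega)).trans hm.le⟩
  set c : ℝ := 2 * (1 + b) + 2 * 2 ^ (2 * b + 3) with hc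
  have hc0 : 0 < c := by positivity
  -- `40 = 10 * 4`: the `10` is from the greedy cost bound, the `4` from `log ≥ w / 2` squared.
  refine ⟨1 / (40 * (1 + b) * c), by positivity, fun K => ?_⟩
  obtain ⟨d₀, hd₀⟩ := exists_nat_ge (10 * K)
  set d := d₀ + 1 with hd
  have hdK : 10 * K ≤ d := by
    rw [hd]
    push_cast
    linarith
  obtain ⟨n, f, hI1, hI2, hopt, hall, hgreedy⟩ := exists_hard_function
    (w := d + 7 + (2 * b + 3)) rfl hε hb hb4 d₀.succ_pos le_rfl
  set w := d + 7 + (2 * b + 3) with hw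
  have hw0 : (0 : ℝ) < w := by exact_mod_cast (by omega : 0 < w)
  have key : ∀ S : Strategy n, S.QueriesMostInfluential f → S.error f ≤ ε →
      optCost f (unitCost n) ε * (1 / (40 * (1 + b) * c) * f.totalInfluence /
        Real.log (2 + f.totalInfluence) ^ 2) ≤ S.expectedCost (unitCost n) := by
    intro S hS hSe
    refine le_trans ?_ (hgreedy S hS hSe)
    have hpow : (0 : ℝ) < 2 ^ w := by positivity
    have hlog : (w : ℝ) / 2 ≤ Real.log (2 + f.totalInfluence) := by
      have h1 : Real.log (2 ^ w) ≤ Real.log (2 + f.totalInfluence) :=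
        Real.log_le_log hpow (by linarith)
      rw [Real.log_pow] at h1
      have h2 : (w : ℝ) * (1 / 2) ≤ w * Real.log 2 := by
        gcongr
        linarith [Real.log_two_gt_d9]
      linarith
    have hlog2 : ((w : ℝ) / 2) ^ 2 ≤ Real.log (2 + f.totalInfluence) ^ 2 :=
      pow_le_pow_left₀ (by positivity) hlog 2
    have hI0 : 0 ≤ f.totalInfluence := hpow.le.trans hI1
    calc optCost f (unitCost n) ε * (1 / (40 * (1 + b) * c) * f.totalInfluence /
          Real.log (2 + f.totalInfluence) ^ 2)
        ≤ ((1 + b) * 2 ^ w * w) * (1 / (40 * (1 + b) * c) * (w * 2 ^ w * c) /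
          ((w : ℝ) / 2) ^ 2) := by
          gcongr
      _ = 2 ^ w * 2 ^ w / 10 := by
          field_simp
          norm_num
  refine ⟨n, f, ?_, ?_, fun B S _ hS hSe => key S hS.queriesMostInfluential hSe, key⟩
  · refine le_trans ?_ hI1
    have h1 : (w : ℝ) ≤ 2 ^ w := by exact_mod_cast Nat.lt_two_pow_self.le
    have h2 : (d : ℝ) ≤ w := by exact_mod_cast (by omega : d ≤ w)
    have h3 : (0 : ℝ) ≤ d := by positivity
    by_cases hK : 0 ≤ K
    · linarith
    · linarith
  -- The infimum of the empty set would be `0`, so an admissible strategy is needed: reading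
  -- everything makes no error.
  · have hne : {r : ℝ | ∃ S : Strategy n, S.error f ≤ ε ∧ r = S.expectedCost (unitCost n)}.Nonempty := by
      refine ⟨_, Strategy.readAll f (List.finRange n) fun _ => false, ?_, rfl⟩
      refine le_trans (le_of_eq ?_) hε0.le
      simp [Strategy.error, Strategy.errorAt_readAll]
    refine le_csInf hne ?_
    rintro r ⟨S, hS, rfl⟩
    exact le_trans (by linarith) (hall S hS)
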